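/- A $(2,m,n)$-group ($m,n$ positive integers) is a triple $(G,g,h)$ where $G$ is a group generated by $g$ and $h$, $g$ has order $m$, $h$ has order $n$, and $(gh)^2=1$; its Euler characteristic (for $G$ finite) is $\chi=|G|\left(\frac1m-\frac12+\frac1n\right)$. A group $S$ is almost simple with socle $T$ if $T$ is a finite nonabelian simple group and, up to isomorphism, $T\cong\mathrm{Inn}(T)\le S\le \mathrm{Aut}(T)$. Write $[m,n]$ for the least common multiple. Let $(G,g,h)$ be a finite non-solvable $(2,m,n)$-group whose Euler characteristic $\chi$ is divisible by exactly two primes, $2$ and the odd prime $s$. Let $O_{2,s}(G)$ be the largest normal subgroup of $G$ whose order has the form $2^as^b$ with $a,b\ge 0$, and put $\overline G=G/O_{2,s}(G)$. Let $K\cong M\times T_1\times\cdots\times T_k$ ($k\ge1$) be a normal subgroup of $\overline G$ such that $M$ is solvable with cyclic Fitting subgroup of odd order, $T_1,\dots,T_k$ are nonabelian simple groups, for all $i\ne j$ the greatest common divisor of $|T_i|$ and $|T_j|$ has the form $2^as^b$ with $a,b\ge0$, and $\overline G/K$ is isomorphic to a subgroup of $\mathrm{Out}(T_1\times\cdots\times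 T_k)$. Then for every $i=1,\dots,k$ there exist an almost simple group $S_i$ with socle $T_i$ and positive integers $m_i,n_i$ such that $S_i$ is a $(2,m_i,n_i)$-group (for some pair of generators) and $$\frac{|S_i|}{[m_i,n_i]}=2^as^b$$ for some non-negative integers $a,b$. -/

import Mathlib

universe u v w

/-- `(G, g, h)` is a `(2,m,n)`-group: `g` has order `m`, `h` has order `n`, and `G` has a
presentation on the generators `g`, `h` whose relators include `g ^ m`, `h ^ n`, `(g * h) ^ 2`;
that is, `g` and `h` generate `G` and these relations hold. -/
structure IsTwoGroupTriple {G : Type*} [Group G] (g h : G) (m n : ℕ) : Prop where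
  m_pos : 0 < m
  n_pos : 0 < n
  orderOf_left : orderOf g = m
  orderOf_right : orderOf h = n
  mul_sq : (g * h) ^ 2 = 1
  closure_eq_top : Subgroup.closure {g, h} = ⊤

/-- The Euler characteristic `|G| (1/m - 1/2 + 1/n)` of a `(2,m,n)`-group `G`. -/
noncomputable def eulerChar (G : Type*) [Group G] (m n : ℕ) : ℚ :=
  (Nat.card G : ℚ) * (1 / (m : ℚ) - 1 / 2 + 1 / (n : ℚ))

/-- The rational number `x` is an integer multiple of `p`. -/
def DvdRat (p : ℕ) (x : ℚ) : Prop := ∃ z : ℤ, x = (p : ℚ) * (z : ℚ)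

/-- `O_{p,s}(G)`, the largest normal subgroup of the finite group `G` of order `p ^ a * s ^ b`
for some `a, b ≥ 0`: the join of all such normal subgroups. -/
def twoPrimeCore (p s : ℕ) (G : Type*) [Group G] : Subgroup G :=
  sSup {K : Subgroup G | K.Normal ∧ ∃ a b : ℕ, Nat.card K = p ^ a * s ^ b}

instance twoPrimeCore_normal (p s : ℕ) (G : Type*) [Group G] : (twoPrimeCore p s G).Normal :=
  Subgroup.sSup_normal _ fun _ hK => hK.1

/-- The Fitting subgroup of a finite group: the join of all nilpotent normal subgroups. -/
def fittingSubgroup (G : Type*) [Group G] : Subgroup G :=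
  sSup {K : Subgroup G | K.Normal ∧ Group.IsNilpotent K}

/-- The group of inner automorphisms. -/
def innerAut (G : Type*) [Group G] : Subgroup (MulAut G) :=
  (MulAut.conj : G →* MulAut G).range

instance innerAut_normal (G : Type*) [Group G] : (innerAut G).Normal where
  conj_mem := by
    rintro _ ⟨x, rfl⟩ f
    refine ⟨f x, ?_⟩
    ext y
    simp [MulAut.conj_apply]

/-- The outer automorphism group. -/
abbrev OutAut (G : Type*) [Group G] : Type _ := MulAut G ⧸ innerAut G

/-- `T` is a nonabelian simple group. -/
def IsNonabelianSimple (T : Type*) [Group T] : Prop :=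
  IsSimpleGroup T ∧ ∃ x y : T, x * y ≠ y * x

/-- `S` is an almost simple group with socle (isomorphic to) the finite nonabelian simple group
`T`: up to isomorphism `T ≤ S ≤ Aut T`, where `T` is identified with its inner automorphisms. -/
def IsAlmostSimpleWithSocle (S T : Type*) [Group S] [Group T] : Prop :=
  Finite T ∧ IsNonabelianSimple T ∧
    ∃ f : S →* MulAut T, Function.Injective f ∧ innerAut T ≤ f.range

/-! Call numbers of the form `2 ^ a * s ^ b` good. Write `|G| = [m, n] * c`. An odd prime dividing
`c` divides the Euler characteristic, so it is `s`; hence `c` is good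
(`card_dvd_lcm_mul_of_eulerChar`). The corresponding ratio for a quotient of `G` divides `c`
(`card_dvd_lcm_orderOf_map_mul`), so it is good too.

It remains to realise `S i` as a quotient of `G`. Conjugation in `G / O_{2,s}(G)` sends `T i` to a
nonabelian simple normal subgroup of `K`, which must be some factor `T j`
(`exists_range_eq_range_factorInclusion`). If `j ≠ i`, then `|T i| = |T j|` is their own gcd and so
is good, which is impossible because `G / O_{2,s}(G)` has trivial core. So `T i` is normal, and `S
i` is the image of `G` in `Aut (T i)`. -/

/-- The natural number `n` has the form `p ^ a * s ^ b`. -/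
def IsTwoPrimeNumber (p s n : ℕ) : Prop := ∃ a b : ℕ, n = p ^ a * s ^ b

namespace IsTwoPrimeNumber

theorem mul {p s m n : ℕ} (hm : IsTwoPrimeNumber p s m) (hn : IsTwoPrimeNumber p s n) :
    IsTwoPrimeNumber p s (m * n) := by
  obtain ⟨a, b, rfl⟩ := hm
  obtain ⟨c, d, rfl⟩ := hn
  exact ⟨a + c, b + d, by ring⟩

theorem of_dvd {p s m n : ℕ} (hp : p.Prime) (hs : s.Prime) (hn : IsTwoPrimeNumber p s n)
    (h : m ∣ n) : IsTwoPrimeNumber p s m := by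
  obtain ⟨a, b, rfl⟩ := hn
  obtain ⟨x, y, hx, hy, rfl⟩ := exists_dvd_and_dvd_of_dvd_mul h
  obtain ⟨i, -, rfl⟩ := (Nat.dvd_prime_pow hp).1 hx
  obtain ⟨j, -, rfl⟩ := (Nat.dvd_prime_pow hs).1 hy
  exact ⟨i, j, rfl⟩

theorem of_forall_prime_dvd {p s n : ℕ} (hn : n ≠ 0)
    (h : ∀ q : ℕ, q.Prime → q ∣ n → q = p ∨ q = s) : IsTwoPrimeNumber p s n := by
  induction n using induction_on_primes with
  | zero => exact absurd rfl hn
  | one => exact ⟨0, 0, by simp⟩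
  | prime_mul q n hq ih =>
    refine mul ?_ (ih (right_ne_zero_of_mul hn) fun r hr hrn => h r hr (hrn.mul_left q))
    rcases h q hq (dvd_mul_right q n) with rfl | rfl
    · exact ⟨1, 0, by simp⟩
    · exact ⟨0, 1, by simp⟩

end IsTwoPrimeNumber

/-! ### The core `O_{p,s}`. -/

section TwoPrimeCore

variable {p s : ℕ} {G : Type*} [Group G]

theorem le_twoPrimeCore {N : Subgroup G} (hN : N.Normal)
    (h : IsTwoPrimeNumber p s (Nat.card N)) : N ≤ twoPrimeCore p s G :=
  le_sSup ⟨hN, h⟩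

theorem card_sup_dvd_mul_of_normal (H K : Subgroup G) [K.Normal] :
    Nat.card (H ⊔ K : Subgroup G) ∣ Nat.card H * Nat.card K := by
  rw [← Subgroup.relIndex_bot_left (H ⊔ K), ← Subgroup.relIndex_mul_relIndex ⊥ K (H ⊔ K) bot_le
    le_sup_right, Subgroup.relIndex_bot_left, Subgroup.relIndex_sup_right, mul_comm]
  exact mul_dvd_mul_right (Subgroup.relIndex_dvd_card K H) _

theorem card_twoPrimeCore [Finite G] (hp : p.Prime) (hs : s.Prime) :
    IsTwoPrimeNumber p s (Nat.card (twoPrimeCore p s G)) := by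
  have key : ∀ A : Set (Subgroup G), A.Finite →
      (∀ K ∈ A, K.Normal ∧ IsTwoPrimeNumber p s (Nat.card K)) →
      IsTwoPrimeNumber p s (Nat.card (sSup A : Subgroup G)) := by
    intro A hA
    induction A, hA using Set.Finite.induction_on with
    | empty => exact fun _ => ⟨0, 0, by simp⟩
    | @insert K A _ _ ih =>
      intro h
      have hKA := ih fun L hL => h L (Set.mem_insert_of_mem K hL)
      have hK := h K (Set.mem_insert K A)
      have := hK.1
      rw [sSup_insert, sup_comm]
      exact (hKA.mul hK.2).of_dvd hp hs (card_sup_dvd_mul_of_normal _ _)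
  exact key _ (Set.toFinite _) fun K hK => hK

/-- The preimage of the core of the quotient is normal, and its order is a product of two core
orders, so it already lies in the core of `G`. -/
theorem twoPrimeCore_quotient [Finite G] (hp : p.Prime) (hs : s.Prime) :
    twoPrimeCore p s (G ⧸ twoPrimeCore p s G) = ⊥ := by
  set N := twoPrimeCore p s (G ⧸ twoPrimeCore p s G) with hN
  have hcard : Nat.card (N.comap (QuotientGroup.mk' (twoPrimeCore p s G))) =
      Nat.card (twoPrimeCore p s G) * Nat.card N := by
    have h1 := Subgroup.card_mul_index (N.comap (QuotientGroup.mk' (twoPrimeCore p s G)))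
    rw [Subgroup.index_comap_of_surjective _ (QuotientGroup.mk'_surjective _)] at h1
    have h2 := Subgroup.card_mul_index N
    have h3 := Subgroup.card_mul_index (twoPrimeCore p s G)
    rw [Subgroup.index_eq_card, ← h2, ← h1, ← mul_assoc] at h3
    exact (Nat.eq_of_mul_eq_mul_right (Nat.pos_of_ne_zero N.index_ne_zero_of_finite) h3).symm
  have hle := le_twoPrimeCore (p := p) (s := s)
    (N := N.comap (QuotientGroup.mk' (twoPrimeCore p s G))) inferInstance
    (hcard ▸ (card_twoPrimeCore hp hs).mul (card_twoPrimeCore hp hs))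
  rw [eq_bot_iff]
  intro x hx
  obtain ⟨y, rfl⟩ := QuotientGroup.mk'_surjective _ x
  exact (QuotientGroup.eq_one_iff y).2 (hle hx)

instance twoPrimeCore_characteristic : (twoPrimeCore p s G).Characteristic := by
  rw [Subgroup.characteristic_iff_map_le]
  intro φ
  rw [Subgroup.map_le_iff_le_comap]
  refine sSup_le fun K hK => ?_
  rw [← Subgroup.map_le_iff_le_comap]
  refine le_twoPrimeCore (hK.1.map _ φ.surjective) ?_
  rw [Subgroup.card_map_of_injective φ.injective]
  exact hK.2

/-- A normal subgroup of a normal subgroup of `G` whose order is `p ^ a * s ^ b` is trivial if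
`O_{p,s}(G)` is. -/
theorem eq_bot_of_twoPrimeCore_eq_bot [Finite G] (hp : p.Prime) (hs : s.Prime)
    (hG : twoPrimeCore p s G = ⊥) {K : Subgroup G} [K.Normal] {N : Subgroup K} (hN : N.Normal)
    (h : IsTwoPrimeNumber p s (Nat.card N)) : N = ⊥ := by
  -- The core is characteristic in `K`, hence normal in `G`.
  have hle : (twoPrimeCore p s K).map K.subtype ≤ twoPrimeCore p s G := by
    refine le_twoPrimeCore inferInstance ?_
    rw [Subgroup.card_map_of_injective K.subtype_injective]
    exact card_twoPrimeCore hp hs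
  rw [hG, le_bot_iff, Subgroup.map_eq_bot_iff_of_injective _ K.subtype_injective] at hle
  exact le_bot_iff.1 (hle ▸ le_twoPrimeCore hN h)

end TwoPrimeCore

/-! ### Quotients and Euler characteristics of `(2,m,n)`-groups. -/

section TwoGroupTriple

variable {G H : Type*} [Group G] [Group H]

theorem IsTwoGroupTriple.map [Finite H] {g h : G} {m n : ℕ} (hG : IsTwoGroupTriple g h m n)
    {f : G →* H} (hf : Function.Surjective f) :
    IsTwoGroupTriple (f g) (f h) (orderOf (f g)) (orderOf (f h)) where
  m_pos := orderOf_pos _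
  n_pos := orderOf_pos _
  orderOf_left := rfl
  orderOf_right := rfl
  mul_sq := by rw [← map_mul, ← map_pow, hG.mul_sq, map_one]
  closure_eq_top := by
    rw [← Set.image_pair, ← MonoidHom.map_closure, hG.closure_eq_top,
      Subgroup.map_top_of_surjective f hf]

theorem orderOf_dvd_orderOf_map_mul_card_ker [Finite G] (f : G →* H) (g : G) :
    orderOf g ∣ orderOf (f g) * Nat.card f.ker := by
  apply orderOf_dvd_of_pow_eq_one
  have hmem : g ^ orderOf (f g) ∈ f.ker := by
    rw [MonoidHom.mem_ker, map_pow, pow_orderOf_eq_one]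
  rw [pow_mul]
  exact congrArg Subtype.val (pow_card_eq_one' (x := (⟨_, hmem⟩ : f.ker)))

/-- Passing to the quotient divides the group order by exactly `|ker f|` and the lcm of the orders
by at most that factor. -/
theorem card_dvd_lcm_orderOf_map_mul [Finite G] {f : G →* H} (hf : Function.Surjective f)
    {g h : G} {c : ℕ} (hc : Nat.card G ∣ Nat.lcm (orderOf g) (orderOf h) * c) :
    Nat.card H ∣ Nat.lcm (orderOf (f g)) (orderOf (f h)) * c := by
  have hL : Nat.lcm (orderOf g) (orderOf h) ∣
      Nat.lcm (orderOf (f g)) (orderOf (f h)) * Nat.card f.ker :=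
    Nat.lcm_dvd
      ((orderOf_dvd_orderOf_map_mul_card_ker f g).trans
        (mul_dvd_mul_right (Nat.dvd_lcm_left _ _) _))
      ((orderOf_dvd_orderOf_map_mul_card_ker f h).trans
        (mul_dvd_mul_right (Nat.dvd_lcm_right _ _) _))
  have hcard : Nat.card H * Nat.card f.ker = Nat.card G := by
    rw [← Subgroup.card_mul_index f.ker, Subgroup.index_ker,
      MonoidHom.range_eq_top.2 hf, Subgroup.card_top, mul_comm]
  refine Nat.dvd_of_mul_dvd_mul_right (Nat.card_pos (α := f.ker)) ?_
  rw [hcard, mul_right_comm]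
  exact hc.trans (mul_dvd_mul_right hL c)

theorem card_dvd_lcm_mul_of_eulerChar [Finite G] {g h : G} {m n : ℕ}
    (hG : IsTwoGroupTriple g h m n) {s : ℕ}
    (hchi : ∀ p : ℕ, p.Prime → (DvdRat p (eulerChar G m n) ↔ p = 2 ∨ p = s)) :
    ∃ c, IsTwoPrimeNumber 2 s c ∧ Nat.card G = Nat.lcm m n * c := by
  obtain ⟨c, hc⟩ : Nat.lcm m n ∣ Nat.card G :=
    Nat.lcm_dvd (hG.orderOf_left ▸ orderOf_dvd_natCard g) (hG.orderOf_right ▸ orderOf_dvd_natCard h)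
  refine ⟨c, IsTwoPrimeNumber.of_forall_prime_dvd ?_ ?_, hc⟩
  · rintro rfl
    exact Nat.card_pos.ne' (hc.trans (mul_zero _))
  intro q hq hqc
  rcases eq_or_ne q 2 with rfl | hq2
  · exact Or.inl rfl
  rw [← hchi q hq]
  -- Divisibility by 2 makes the Euler characteristic an integer `2 * z`.
  obtain ⟨z, hz⟩ := (hchi 2 Nat.prime_two).2 (Or.inl rfl)
  obtain ⟨x, hx⟩ := Nat.dvd_lcm_left m n
  obtain ⟨y, hy⟩ := Nat.dvd_lcm_right m n
  obtain ⟨d, rfl⟩ := hqc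
  have hm : (m : ℚ) ≠ 0 := Nat.cast_ne_zero.2 hG.m_pos.ne'
  have hn : (n : ℚ) ≠ 0 := Nat.cast_ne_zero.2 hG.n_pos.ne'
  have hx' : (Nat.lcm m n : ℚ) / m = x := by
    rw [div_eq_iff hm, mul_comm]
    exact_mod_cast hx
  have hy' : (Nat.lcm m n : ℚ) / n = y := by
    rw [div_eq_iff hn, mul_comm]
    exact_mod_cast hy
  -- Doubling clears the `1 / 2`: twice the Euler characteristic is `c * (2 * x - [m, n] + 2 * y)`
  -- with `c = q * d`.
  have key : ((4 * z : ℤ) : ℚ) = ((q * (d * (2 * x - Nat.lcm m n + 2 * y)) : ℤ) : ℚ) := by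
    have : (4 * z : ℚ) = 2 * eulerChar G m n := by rw [hz]; push_cast; ring
    push_cast
    rw [this, eulerChar, hc, ← hx', ← hy']
    push_cast
    ring
  have hdvd : (q : ℤ) ∣ 2 * 2 * z := ⟨_, by exact_mod_cast key⟩
  have hq' : Prime (q : ℤ) := Nat.prime_iff_prime_int.1 hq
  have hq2' : ¬ (q : ℤ) ∣ 2 := fun h =>
    hq2 ((Nat.prime_dvd_prime_iff_eq hq Nat.prime_two).1 (by exact_mod_cast h))
  obtain ⟨w, rfl⟩ := (hq'.dvd_or_dvd hdvd).resolve_left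
    fun h => (hq'.dvd_or_dvd h).elim hq2' hq2'
  exact ⟨2 * w, by rw [hz]; push_cast; ring⟩

end TwoGroupTriple

/-! ### Simple normal subgroups of a direct product. -/

section DirectProduct

theorem IsNonabelianSimple.eq_one_of_forall_commute {T : Type*} [Group T]
    (hT : IsNonabelianSimple T) {t : T} (ht : ∀ u, u * t = t * u) : t = 1 := by
  obtain ⟨hsimple, x, y, hxy⟩ := hT
  rcases (inferInstance : (Subgroup.center T).Normal).eq_bot_or_eq_top with h | h
  · rw [← Subgroup.mem_bot, ← h]
    exact Subgroup.mem_center_iff.2 ht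
  · exact absurd (Subgroup.mem_center_iff.1 (h ▸ Subgroup.mem_top y) x) hxy

theorem IsNonabelianSimple.not_isSolvable {T : Type*} [Group T]
    (hT : IsNonabelianSimple T) : ¬ Group.IsSolvable T := by
  obtain ⟨hsimple, x, y, hxy⟩ := hT
  exact fun h => hxy (IsSimpleGroup.comm_iff_isSolvable.2 h x y)

variable {ι : Type*} [DecidableEq ι] (M : Type*) [Group M] (T : ι → Type*) [∀ i, Group (T i)]

/-- The inclusion of the factor `T i` into `M × ∏ j, T j`. -/
def factorInclusion (i : ι) : T i →* M × (∀ j, T j) :=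
  (MonoidHom.inr M (∀ j, T j)).comp (MonoidHom.mulSingle T i)

theorem factorInclusion_apply (i : ι) (t : T i) :
    factorInclusion M T i t = (1, Pi.mulSingle i t) := rfl

theorem factorInclusion_injective (i : ι) : Function.Injective (factorInclusion M T i) :=
  fun _ _ h => Pi.mulSingle_injective i (congrArg Prod.snd h)

theorem conj_factorInclusion (i : ι) (x : M × (∀ j, T j)) (t : T i) :
    x * factorInclusion M T i t * x⁻¹ = factorInclusion M T i (x.2 i * t * (x.2 i)⁻¹) := by
  ext j
  · simp [factorInclusion_apply]
  · rcases eq_or_ne j i with rfl | hj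
    · simp [factorInclusion_apply]
    · simp [factorInclusion_apply, hj]

instance factorInclusion_range_normal (i : ι) : (factorInclusion M T i).range.Normal where
  conj_mem := by
    rintro _ ⟨t, rfl⟩ x
    exact ⟨_, (conj_factorInclusion M T i x t).symm⟩

variable {M T}

/-- A nonabelian simple normal subgroup of `M × ∏ j, T j`, with `M` solvable and every `T j`
nonabelian simple, is one of the factors `T j`. -/
theorem exists_range_eq_range_factorInclusion (hM : Group.IsSolvable M)
    (hT : ∀ i, IsNonabelianSimple (T i)) {A : Type*} [Group A] (hA : IsNonabelianSimple A)
    {f : A →* M × (∀ j, T j)} (hf : Function.Injective f) (hN : f.range.Normal) :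
    ∃ j, f.range = (factorInclusion M T j).range := by
  by_contra! hne
  have hAs := hA.1
  -- Both groups are simple and normal, so a nontrivial intersection would force them to coincide.
  have hdisj : ∀ j, Disjoint f.range (factorInclusion M T j).range := by
    intro j
    have hTs := (hT j).1
    rcases ((factorInclusion_range_normal M T j).comap f).eq_bot_or_eq_top with h | h
    · rw [Subgroup.disjoint_def]
      rintro _ ⟨a, rfl⟩ ha
      have : a ∈ (factorInclusion M T j).range.comap f := ha
      rw [h, Subgroup.mem_bot] at this
      rw [this, map_one]
    have hle : f.range ≤ (factorInclusion M T j).range := by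
      rintro _ ⟨a, rfl⟩
      exact (h ▸ Subgroup.mem_top a : a ∈ (factorInclusion M T j).range.comap f)
    rcases (hN.comap (factorInclusion M T j)).eq_bot_or_eq_top with h' | h'
    · obtain ⟨a, ha⟩ := exists_ne (1 : A)
      obtain ⟨t, ht⟩ := hle ⟨a, rfl⟩
      have : t ∈ f.range.comap (factorInclusion M T j) := ⟨a, ht.symm⟩
      rw [h', Subgroup.mem_bot] at this
      rw [this, map_one] at ht
      exact absurd (hf (ht.symm.trans (map_one f).symm)) ha
    · refine absurd (le_antisymm hle ?_) (hne j)
      rintro _ ⟨t, rfl⟩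
      exact (h' ▸ Subgroup.mem_top t : t ∈ f.range.comap (factorInclusion M T j))
  -- Disjoint normal subgroups commute, so each coordinate of `f a` is central in a centreless `T
  -- j`. Thus `A` would embed in the solvable group `M`.
  have hsnd : ∀ a, (f a).2 = 1 := by
    intro a
    funext j
    refine (hT j).eq_one_of_forall_commute fun u => ?_
    have hcomm := Subgroup.commute_of_normal_of_disjoint _ _ hN
      (factorInclusion_range_normal M T j) (hdisj j) (f a) (factorInclusion M T j u)
      ⟨a, rfl⟩ ⟨u, rfl⟩
    simpa [factorInclusion_apply] using (congrFun (congrArg Prod.snd hcomm.eq) j).symm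
  refine hA.not_isSolvable (Group.isSolvable_of_isSolvable_injective
    (f := (MonoidHom.fst M (∀ j, T j)).comp f) fun a b hab => hf (Prod.ext hab ?_))
  rw [hsnd, hsnd]

end DirectProduct

/-! ### Conjugation action and the almost simple quotient. -/

/-- A group acts by conjugation on a group embedded as a normal subgroup. -/
theorem exists_conj_hom_of_normal_range {Q T : Type*} [Group Q] [Group T] {f : T →* Q}
    (hf : Function.Injective f) (hN : f.range.Normal) :
    ∃ φ : Q →* MulAut T, ∀ t, φ (f t) = MulAut.conj t := by
  let τ : T ≃* f.range := MonoidHom.ofInjective hf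
  refine ⟨(MulAut.congr τ.symm).toMonoidHom.comp MulAut.conjNormal, fun t => ?_⟩
  ext u
  apply τ.injective
  apply Subtype.ext
  change (τ (τ.symm (MulAut.conjNormal (f t) (τ u))) : Q) = f (MulAut.conj t u)
  rw [τ.apply_symm_apply, MulAut.conjNormal_apply, MulAut.conj_apply, map_mul, map_mul, map_inv]
  rfl

theorem IsAlmostSimpleWithSocle.range {Q T : Type*} [Group Q] [Group T] [Finite T]
    (hT : IsNonabelianSimple T) {f : T → Q} {φ : Q →* MulAut T}
    (hφ : ∀ t, φ (f t) = MulAut.conj t) : IsAlmostSimpleWithSocle φ.range T := by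
  refine ⟨inferInstance, hT, φ.range.subtype, φ.range.subtype_injective, ?_⟩
  rintro _ ⟨t, rfl⟩
  exact ⟨⟨_, f t, hφ t⟩, rfl⟩

theorem mainTheorem3 {G : Type u} [Group G] [Finite G]
    -- `(G, g, h)` is a finite non-solvable `(2,m,n)`-group
    (g h : G) (m n : ℕ) (hG : IsTwoGroupTriple g h m n) (hns : ¬ Group.IsSolvable G)
    -- whose Euler characteristic is divisible by exactly two primes, `2` and `s`
    (s : ℕ) (hs : s.Prime) (hs2 : s ≠ 2)
    (hchi : ∀ p : ℕ, p.Prime → (DvdRat p (eulerChar G m n) ↔ p = 2 ∨ p = s))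
    -- a normal subgroup `K ≅ M × T 0 × ⋯ × T (k - 1)` of `G / O_{2,s}(G)`
    {k : ℕ} (hk : 0 < k)
    {M : Type w} [Group M] {T : Fin k → Type v} [∀ i, Group (T i)]
    (K : Subgroup (G ⧸ twoPrimeCore 2 s G)) [K.Normal]
    (e : K ≃* M × (∀ i, T i))
    (hM : Group.IsSolvable M)
    (hFcyc : IsCyclic (fittingSubgroup M)) (hFodd : Odd (Nat.card (fittingSubgroup M)))
    (hT : ∀ i, IsNonabelianSimple (T i))
    (hgcd : ∀ i j, i ≠ j →
      ∃ a b : ℕ, Nat.gcd (Nat.card (T i)) (Nat.card (T j)) = 2 ^ a * s ^ b)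
    (hOut : ∃ f : ((G ⧸ twoPrimeCore 2 s G) ⧸ K) →* OutAut (∀ i, T i), Function.Injective f) :
    ∀ i, ∃ (S : Type v) (_ : Group S), IsAlmostSimpleWithSocle S (T i) ∧
      ∃ (x y : S) (mi ni : ℕ), IsTwoGroupTriple x y mi ni ∧
        ∃ a b : ℕ, (Nat.card S : ℚ) / (Nat.lcm mi ni : ℚ) = 2 ^ a * (s : ℚ) ^ b := by
  intro i
  have h2 := Nat.prime_two
  have hcore := twoPrimeCore_quotient (G := G) h2 hs
  let r (j : Fin k) : T j →* K := e.symm.toMonoidHom.comp (factorInclusion M T j)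
  have hr : ∀ j, Function.Injective (r j) := fun j =>
    e.symm.injective.comp (factorInclusion_injective M T j)
  have hrnormal : ∀ j, (r j).range.Normal := by
    intro j
    rw [MonoidHom.range_comp]
    exact (factorInclusion_range_normal M T j).map _ e.symm.surjective
  have hTfin : ∀ j, Finite (T j) := fun j => Finite.of_injective _ (hr j)
  -- Otherwise `T j` would lie in the trivial core.
  have hTcard : ∀ j, ¬ IsTwoPrimeNumber 2 s (Nat.card (T j)) := by
    intro j hj
    have hcard : Nat.card (r j).range = Nat.card (T j) :=
      (Nat.card_congr (MonoidHom.ofInjective (hr j)).toEquiv).symm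
    have hbot := eq_bot_of_twoPrimeCore_eq_bot h2 hs hcore (hrnormal j) (hcard ▸ hj)
    have := (hT j).1
    rw [hbot, Subgroup.card_bot] at hcard
    exact (Finite.one_lt_card_iff_nontrivial (α := T j) |>.2 inferInstance).ne hcard
  let f : T i →* G ⧸ twoPrimeCore 2 s G := K.subtype.comp (r i)
  have hf : Function.Injective f := K.subtype_injective.comp (hr i)
  have hN : f.range.Normal := by
    refine ⟨?_⟩
    rintro _ ⟨t, rfl⟩ x
    -- Conjugation by `x` need not be inner on `K`, so it may a priori permute the factors.
    let c : K ≃* K := MulAut.conjNormal x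
    let f' : T i →* M × (∀ j, T j) := (e.toMonoidHom.comp c.toMonoidHom).comp (r i)
    have hf' : Function.Injective f' := (e.injective.comp c.injective).comp (hr i)
    have hN' : f'.range.Normal := by
      rw [MonoidHom.range_comp]
      exact (hrnormal i).map _ (e.surjective.comp c.surjective)
    obtain ⟨j, hj⟩ := exists_range_eq_range_factorInclusion hM hT (hT i) hf' hN'
    have hcard : Nat.card (T i) = Nat.card (T j) := by
      rw [Nat.card_congr (MonoidHom.ofInjective hf').toEquiv, hj]
      exact (Nat.card_congr
        (MonoidHom.ofInjective (factorInclusion_injective M T j)).toEquiv).symm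
    obtain rfl : i = j := by
      by_contra hij
      refine hTcard i ?_
      have := hgcd i j hij
      rwa [← hcard, Nat.gcd_self] at this
    obtain ⟨u, hu⟩ := hj.le (⟨t, rfl⟩ : f' t ∈ f'.range)
    refine ⟨u, ?_⟩
    have hu' : r i u = c (r i t) := e.injective ((e.apply_symm_apply _).trans hu)
    exact (congrArg Subtype.val hu').trans (MulAut.conjNormal_apply x (r i t))
  obtain ⟨φ, hφ⟩ := exists_conj_hom_of_normal_range hf hN
  refine ⟨φ.range, inferInstance, IsAlmostSimpleWithSocle.range (hT i) hφ, ?_⟩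
  let ψ : G →* φ.range := φ.rangeRestrict.comp (QuotientGroup.mk' (twoPrimeCore 2 s G))
  have hψ : Function.Surjective ψ :=
    φ.rangeRestrict_surjective.comp (QuotientGroup.mk'_surjective _)
  have : Finite φ.range := Finite.of_surjective ψ hψ
  -- The exponents are the orders of the images, which may be proper divisors of `m` and `n`.
  refine ⟨ψ g, ψ h, _, _, hG.map hψ, ?_⟩
  obtain ⟨c, hc, hGc⟩ := card_dvd_lcm_mul_of_eulerChar hG hchi
  rw [← hG.orderOf_left, ← hG.orderOf_right] at hGc
  have hdvd := card_dvd_lcm_orderOf_map_mul hψ hGc.dvd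
  obtain ⟨d, hd⟩ := Nat.lcm_dvd (orderOf_dvd_natCard (ψ g)) (orderOf_dvd_natCard (ψ h))
  have hL : 0 < Nat.lcm (orderOf (ψ g)) (orderOf (ψ h)) :=
    Nat.lcm_pos (orderOf_pos _) (orderOf_pos _)
  rw [hd] at hdvd
  obtain ⟨a, b, hab⟩ := hc.of_dvd h2 hs (Nat.dvd_of_mul_dvd_mul_left hL hdvd)
  refine ⟨a, b, ?_⟩
  rw [hd, Nat.cast_mul, mul_div_cancel_left₀ _ (Nat.cast_ne_zero.2 hL.ne'), hab]
  push_cast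
  rfl
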